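/- Let $d\ge 1$ and $x_0\in(0,1)^d$. A smoothness level is $\alpha=(\alpha_1,\dots,\alpha_d)$ for which there is $0\le s\le d$ such that $\alpha_1,\dots,\alpha_s$ are positive integers and $\alpha_{s+1}=\dots=\alpha_d=\infty$. The design is either a fixed lattice with parameters $\beta_k>0$, $\sum_{k=1}^d\beta_k=1$, or uniform random on $[0,1]^d$. The critical index $\kappa_*\in\{1,\dots,d\}$ is the unique maximiser of $\ell\mapsto \big(\sum_{k=\ell}^d\beta_k\big)/\big(2+\sum_{k=\ell}^s\alpha_k^{-1}\big)$ for the lattice design (assumed to be unique), and $\kappa_*=1$ for the random design. Let $\mathbb G$ be a centred Gaussian process on $\mathbb R_{\ge0}^d\times\mathbb R_{\ge0}^d$ with almost surely continuous sample paths and $$\mathrm{Cov}\big(\mathbb G(g_1,g_2),\mathbb G(g_1',g_2')\big)=\prod_{k=\kappa_*}^d\big((g_1)_k\wedge(g_1')_k+(g_2)_k\wedge(g_2')_k\big).$$ Put $\mathscr G_1=\{g>0: g_k\le (x_0)_k,\ s<k\le d\}$, $\mathscr G_2=\{g>0: g_k\le (1-x_0)_k,\ s<k\le d\}$, where $g>0$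 is meant coordinatewise, $$\mathbb V_\alpha(g_1,g_2)=\frac{\mathbb G(g_1,g_2)}{\prod_{k=\kappa_*}^d\big((g_1)_k+(g_2)_k\big)}+\sum_{k=\kappa_*}^s\frac{(g_2)_k^{\alpha_k+1}-(g_1)_k^{\alpha_k+1}}{(g_2)_k+(g_1)_k},$$ $$\mathbb V_\alpha^-=\sup_{g_1\in\mathscr G_1}\inf_{g_2\in\mathscr G_2}\mathbb V_\alpha(g_1,g_2),\qquad \mathbb V_\alpha^+=\inf_{g_2\in\mathscr G_2}\sup_{g_1\in\mathscr G_1}\mathbb V_\alpha(g_1,g_2)$$ (empty sums are $0$ and empty products are $1$). Let $g_1^*\in\mathscr G_1$ and $g_2^*\in\mathscr G_2$ be such that $\inf_{g_2\in\mathscr G_2}\mathbb V_\alpha(g_1^*,g_2)=\mathbb V_\alpha^-$ and $\sup_{g_1\in\mathscr G_1}\mathbb V_\alpha(g_1,g_2^*)=\mathbb V_\alpha^+$, and let $$\mathbb L_\alpha=\sqrt{\prod_{k=\kappa_*}^s(g_1^*+g_2^*)_k}\;\cdot\;\frac{\mathbb V_\alpha^-+\mathbb V_\alpha^+}{2}.$$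 (Almost surely such $g_1^*,g_2^*$ exist and are unique in the coordinates $k\ge\kappa_*$, the only ones that matter. The event $\{|\mathbb L_\alpha|>t\}$ below is read as the event that some such pair $(g_1^*,g_2^*)$ gives a value of absolute value larger than $t$; its outer probability is bounded.) 1. There is a constant $L_0>0$ depending only on $d$ and $x_0$ such that for all $t\ge1$, all smoothness levels $\alpha$ and all designs with critical index $\kappa_*$, $$\mathbb P\big(|\mathbb L_\alpha|>t\big)\le L_0\exp\big(-t^{4/(d+2)}/L_0\big).$$ 2. Consequently, for every $\delta_0\in(0,1)$ there is a constant $C>0$ depending only on $d$, $x_0$ and $\delta_0$ such that for all $\delta\in(0,\delta_0]$ the critical value $c_\delta=C\log^{(d+2)/4}(1/\delta)$ satisfies $\mathbb P(|\mathbb L_\alpha|>c_\delta)\le\delta$ for all smoothness levels $\alpha$ and all designs with critical index $\kappa_*$. -/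

import Mathlib

open MeasureTheory ProbabilityTheory
open scoped NNReal ENNReal

universe u

noncomputable section

namespace BlockIsotonic

/-- A local smoothness level `α = (α_1, …, α_d)` with intrinsic dimension `s`: the first `s`
exponents are positive integers, the remaining ones are infinite. -/
structure Smoothness (d : ℕ) where
  /-- the intrinsic dimension -/
  s : ℕ
  s_le : s ≤ d
  /-- the exponents `α_k` -/
  exponent : Fin d → ℕ∞
  one_le : ∀ k, 1 ≤ exponent k
  lt_top_iff : ∀ k, exponent k < ⊤ ↔ (k : ℕ) < s

/-- The type of the design: a fixed lattice with about `n ^ β_k` points in direction `k`,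
where `β_k > 0` and `∑ β_k = 1`, or the uniform random design. -/
inductive Design (d : ℕ) where
  | lattice (β : Fin d → ℝ) (pos : ∀ k, 0 < β k) (sum_eq_one : ∑ k, β k = 1) : Design d
  | random : Design d

variable {d : ℕ}

/-- The coordinates `κ ≤ k ≤ d`. -/
def upperCoords (κ : Fin d) : Finset (Fin d) := Finset.univ.filter fun k => κ ≤ k

/-- The coordinates `κ ≤ k ≤ s`. -/
def activeCoords (α : Smoothness d) (κ : Fin d) : Finset (Fin d) :=
  Finset.univ.filter fun k => κ ≤ k ∧ (k : ℕ) < α.s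

/-- The finite exponents as natural numbers (used for the first `s` coordinates only). -/
def Smoothness.exp (α : Smoothness d) (k : Fin d) : ℕ := (α.exponent k).toNat

/-- The criterion `(∑_{k = ℓ}^d β_k) / (2 + ∑_{k = ℓ}^s 1 / α_k)`. -/
def latticeCriterion (β : Fin d → ℝ) (α : Smoothness d) (l : Fin d) : ℝ :=
  (∑ k ∈ upperCoords l, β k) / (2 + ∑ k ∈ activeCoords α l, ((α.exp k : ℝ))⁻¹)

/-- `κ` is the critical index `κ_*` of the design at smoothness `α`: the unique maximiser of the
criterion for a lattice design, and the first index for a random design. -/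
def IsCriticalIndex (α : Smoothness d) (κ : Fin d) : Design d → Prop
  | .lattice β _ _ => ∀ l, l ≠ κ → latticeCriterion β α l < latticeCriterion β α κ
  | .random => (κ : ℕ) = 0

/-- Points of `[0, ∞)^d`. -/
abbrev Orthant (d : ℕ) : Type := Fin d → ℝ≥0

/-- A version with almost surely continuous sample paths of the centred Gaussian process `𝔾`
on `[0, ∞)^d × [0, ∞)^d` with covariance
`∏_{k = κ}^d ((g₁)_k ∧ (g₁')_k + (g₂)_k ∧ (g₂')_k)`. -/
structure IsNoise {Ω : Type*} [MeasurableSpace Ω] (P : Measure Ω) (κ : Fin d)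
    (G : Orthant d × Orthant d → Ω → ℝ) : Prop where
  gaussian : IsGaussianProcess G P
  centered : ∀ g, ∫ ω, G g ω ∂P = 0
  covariance_eq : ∀ g g', cov[G g, G g'; P] =
    ∏ k ∈ upperCoords κ, ((min (g.1 k) (g'.1 k) + min (g.2 k) (g'.2 k) : ℝ≥0) : ℝ)
  continuous_paths : ∀ᵐ ω ∂P, Continuous fun g => G g ω

/-- `𝒢₁ = {g > 0 : g_k ≤ (x₀)_k for s < k ≤ d}`. -/
def G1 (x₀ : Fin d → ℝ) (α : Smoothness d) : Set (Orthant d) :=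
  {g | (∀ k, 0 < g k) ∧ ∀ k : Fin d, α.s ≤ (k : ℕ) → (g k : ℝ) ≤ x₀ k}

/-- `𝒢₂ = {g > 0 : g_k ≤ (1 - x₀)_k for s < k ≤ d}`. -/
def G2 (x₀ : Fin d → ℝ) (α : Smoothness d) : Set (Orthant d) :=
  {g | (∀ k, 0 < g k) ∧ ∀ k : Fin d, α.s ≤ (k : ℕ) → (g k : ℝ) ≤ 1 - x₀ k}

/-- `𝕍_α(g₁, g₂)`, for one sample path `γ` of `𝔾`. -/
def V (α : Smoothness d) (κ : Fin d) (γ : Orthant d × Orthant d → ℝ) (g₁ g₂ : Orthant d) : ℝ :=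
  γ (g₁, g₂) / ∏ k ∈ upperCoords κ, ((g₁ k : ℝ) + g₂ k) +
    ∑ k ∈ activeCoords α κ,
      ((g₂ k : ℝ) ^ (α.exp k + 1) - (g₁ k : ℝ) ^ (α.exp k + 1)) / ((g₂ k : ℝ) + g₁ k)

/-- `sup_{g₁ ∈ 𝒢₁} inf_{g₂ ∈ 𝒢₂} 𝕍_α(g₁, g₂)`, as an extended real number. -/
def VSupInf (x₀ : Fin d → ℝ) (α : Smoothness d) (κ : Fin d)
    (γ : Orthant d × Orthant d → ℝ) : EReal :=
  ⨆ g₁ ∈ G1 x₀ α, ⨅ g₂ ∈ G2 x₀ α, (V α κ γ g₁ g₂ : EReal)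

/-- `inf_{g₂ ∈ 𝒢₂} sup_{g₁ ∈ 𝒢₁} 𝕍_α(g₁, g₂)`, as an extended real number. -/
def VInfSup (x₀ : Fin d → ℝ) (α : Smoothness d) (κ : Fin d)
    (γ : Orthant d × Orthant d → ℝ) : EReal :=
  ⨅ g₂ ∈ G2 x₀ α, ⨆ g₁ ∈ G1 x₀ α, (V α κ γ g₁ g₂ : EReal)

/-- `(g₁, g₂)` is a pair `(g₁*, g₂*)`: `g₁ ∈ 𝒢₁` attains the outer supremum in `sup inf 𝕍_α`
and `g₂ ∈ 𝒢₂` attains the outer infimum in `inf sup 𝕍_α`. -/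
structure IsOptimalPair (x₀ : Fin d → ℝ) (α : Smoothness d) (κ : Fin d)
    (γ : Orthant d × Orthant d → ℝ) (g₁ g₂ : Orthant d) : Prop where
  mem₁ : g₁ ∈ G1 x₀ α
  mem₂ : g₂ ∈ G2 x₀ α
  attains₁ : (⨅ g ∈ G2 x₀ α, (V α κ γ g₁ g : EReal)) = VSupInf x₀ α κ γ
  attains₂ : (⨆ g ∈ G1 x₀ α, (V α κ γ g g₂ : EReal)) = VInfSup x₀ α κ γ

/-- `𝕊_α(g₁, g₂) = (∏_{k = κ}^s (g₁ + g₂)_k)^{1/2}`. -/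
def S (α : Smoothness d) (κ : Fin d) (g₁ g₂ : Orthant d) : ℝ :=
  Real.sqrt (∏ k ∈ activeCoords α κ, ((g₂ k : ℝ) + g₁ k))

/-- The value `𝕊_α(g₁, g₂) · (sup inf 𝕍_α + inf sup 𝕍_α) / 2` for one sample path `γ` of `𝔾`;
at an optimal pair this is the value of `𝕃_α`. -/
def limitValue (x₀ : Fin d → ℝ) (α : Smoothness d) (κ : Fin d)
    (γ : Orthant d × Orthant d → ℝ) (g₁ g₂ : Orthant d) : EReal :=
  ((S α κ g₁ g₂ * (1 / 2) : ℝ) : EReal) * (VSupInf x₀ α κ γ + VInfSup x₀ α κ γ)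

/-- The event `|𝕃_α| > t`: some optimal pair `(g₁*, g₂*)` gives a value of `𝕃_α` whose absolute
value (possibly infinite) exceeds `t`. Almost surely optimal pairs exist and are unique in the
coordinates `k ≥ κ`, the only ones that enter the value; taking all optimal pairs avoids any
choice on the exceptional null set and dominates every measurable selection. -/
def exceedance {Ω : Type*} (x₀ : Fin d → ℝ) (α : Smoothness d) (κ : Fin d)
    (G : Orthant d × Orthant d → Ω → ℝ) (t : ℝ) : Set Ω :=
  {ω | ∃ g₁ g₂, IsOptimalPair x₀ α κ (fun g => G g ω) g₁ g₂ ∧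
    ENNReal.ofReal t < (limitValue x₀ α κ (fun g => G g ω) g₁ g₂).abs}

end BlockIsotonic

end

/-! ### Finite Gaussian families: identification of laws and a Chernoff bound. -/

section GaussianFamily

variable {Ω T : Type*} [MeasurableSpace Ω] {P : Measure Ω}

/-! The optimisation over two arguments is compared with two frozen points, `b₁ = x₀` and `b₂ = 1 -
x₀`, which are admissible at every smoothness level.

Probabilistic part. With one argument frozen at `b`, the noise divided by `∏ (g_k + b_k)` has
covariance `∏ min (1 / (g_k + b_k)) (1 / (g'_k + b_k))`: it is a Brownian sheet in the decreasing
times `1 / (g_k + b_k)`, hence a sheet on a bounded box. Lévy's reflection inequality, applied to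
one coordinate after another, costs a factor `2` each time and leaves only the value at `g = 0`, a
Gaussian of variance at most `∏ b_k⁻¹`. So the whole section is bounded by `u` outside an event of
probability of order `exp (-u ^ 2 / (2 σ))`, uniformly in `α` and `κ`
(`IsNoise.measure_exists_lt_le`).

Deterministic part (`abs_limitValue_le`). If both sections are bounded by `u`, testing with `b₁` and
`b₂` confines `sup inf` and `inf sup` to `[-(u + d), u + d]`. Testing the optimal points against
`b₂` and `b₁` bounds their bias, which grows at least linearly in each active coordinate, so these
coordinates are `O(u + d + 1)`. The square root of at most `d` such factors, times the bound on the
values, has order `(u + d + 1) ^ ((d + 2) / 2)`. Solving for `u` gives `u` of order `t ^ (2 / (d +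
2))`, and the Gaussian tail yields the exponent `4 / (d + 2)`. -/

theorem ProbabilityTheory.IsGaussianProcess.hasGaussianLaw_pi [Finite T] {X : T → Ω → ℝ}
    (hX : IsGaussianProcess X P) : HasGaussianLaw (fun ω t => X t ω) P := by
  have := Fintype.ofFinite T
  exact (hX.hasGaussianLaw Finset.univ).map_fun
    (ContinuousLinearMap.pi fun t =>
      ContinuousLinearMap.proj (φ := fun _ : (Finset.univ : Finset T) => ℝ) ⟨t, Finset.mem_univ t⟩)

/-- The law of a finite Gaussian family is determined by its means and covariances. -/
theorem ProbabilityTheory.IsGaussianProcess.map_eq_of_covariance_eq [Finite T]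
    {X Y : T → Ω → ℝ} (hX : IsGaussianProcess X P) (hY : IsGaussianProcess Y P)
    (hm : ∀ t, ∫ ω, X t ω ∂P = ∫ ω, Y t ω ∂P)
    (hc : ∀ s t, cov[X s, X t; P] = cov[Y s, Y t; P]) :
    P.map (fun ω t => X t ω) = P.map (fun ω t => Y t ω) := by
  classical
  have := Fintype.ofFinite T
  have hP := hX.isProbabilityMeasure
  have hX' := hX.hasGaussianLaw_pi
  have hY' := hY.hasGaussianLaw_pi
  have := hX'.isGaussian_map
  have := hY'.isGaussian_map
  -- For a Gaussian law, the characteristic function at `L` depends only on the mean and variance of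
  -- `L`, which are linear and quadratic in the given data.
  refine Measure.ext_of_charFunDual (funext fun L => ?_)
  obtain ⟨c, hL⟩ : ∃ c : T → ℝ, ∀ x : T → ℝ, L x = ∑ t, c t * x t := by
    refine ⟨fun t => L (Pi.single t 1), fun x => ?_⟩
    conv_lhs => rw [← Finset.univ_sum_single x]
    rw [map_sum]
    refine Finset.sum_congr rfl fun t _ => ?_
    have : (Pi.single t (x t) : T → ℝ) = x t • Pi.single t 1 := by
      rw [← Pi.single_smul]; simp
    rw [this, map_smul, smul_eq_mul, mul_comm]
  have hXm : ∀ t, MemLp (X t) 2 P := fun t => (hX.hasGaussianLaw_eval t).memLp_two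
  have hYm : ∀ t, MemLp (Y t) 2 P := fun t => (hY.hasGaussianLaw_eval t).memLp_two
  have hmean : ∫ ω, L (fun t => X t ω) ∂P = ∫ ω, L (fun t => Y t ω) ∂P := by
    simp_rw [hL]
    rw [integral_finsetSum _ fun t _ => ((hXm t).integrable one_le_two).const_mul _,
      integral_finsetSum _ fun t _ => ((hYm t).integrable one_le_two).const_mul _]
    simp_rw [integral_const_mul, hm]
  have hvar : Var[fun ω => L (fun t => X t ω); P] = Var[fun ω => L (fun t => Y t ω); P] := by
    simp_rw [hL]
    have hXs : MemLp (fun ω => ∑ t, c t * X t ω) 2 P :=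
      memLp_finsetSum _ fun t _ => (hXm t).const_mul _
    have hYs : MemLp (fun ω => ∑ t, c t * Y t ω) 2 P :=
      memLp_finsetSum _ fun t _ => (hYm t).const_mul _
    rw [← covariance_self hXs.aemeasurable, ← covariance_self hYs.aemeasurable,
      covariance_fun_sum_fun_sum (fun t => (hXm t).const_mul _) (fun t => (hXm t).const_mul _),
      covariance_fun_sum_fun_sum (fun t => (hYm t).const_mul _) (fun t => (hYm t).const_mul _)]
    simp_rw [covariance_const_mul_left, covariance_const_mul_right, hc]
  rw [hX'.charFunDual_map_eq_fun, hY'.charFunDual_map_eq_fun, hmean, hvar]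

/-- Two-sided Chernoff bound for a centred Gaussian variable. -/
theorem ProbabilityTheory.HasGaussianLaw.measure_lt_abs_le {X : Ω → ℝ} (hX : HasGaussianLaw X P)
    (hm : ∫ ω, X ω ∂P = 0) {v : ℝ} (hv : Var[X; P] ≤ v) (hv0 : 0 < v) {u : ℝ} (hu : 0 ≤ u) :
    P {ω | u < |X ω|} ≤ 2 * ENNReal.ofReal (Real.exp (-u ^ 2 / (2 * v))) := by
  have hP := hX.isProbabilityMeasure
  have one_sided : ∀ Y : Ω → ℝ, HasGaussianLaw Y P → ∫ ω, Y ω ∂P = 0 → Var[Y; P] ≤ v →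
      P {ω | u ≤ Y ω} ≤ ENNReal.ofReal (Real.exp (-u ^ 2 / (2 * v))) := by
    intro Y hY hYm hYv
    have hlaw := hY.map_eq_gaussianReal
    rw [hYm] at hlaw
    have hsub : HasSubgaussianMGF Y v.toNNReal P := by
      refine ⟨fun t => ?_, fun t => ?_⟩
      · have h := integrable_exp_mul_gaussianReal (μ := 0) (v := Var[Y; P].toNNReal) t
        rw [← hlaw] at h
        exact (integrable_map_measure h.aestronglyMeasurable hY.aemeasurable).1 h
      · rw [mgf_gaussianReal hlaw, zero_mul, zero_add]
        gcongr
    have h := hsub.measure_ge_le hu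
    rw [Real.coe_toNNReal _ hv0.le] at h
    exact (ENNReal.le_ofReal_iff_toReal_le (measure_ne_top _ _) (Real.exp_nonneg _)).2 h
  have hsubset : {ω | u < |X ω|} ⊆ {ω | u ≤ X ω} ∪ {ω | u ≤ -X ω} := fun ω hω => by
    rcases lt_abs.1 (show u < |X ω| from hω) with h | h
    · exact Or.inl h.le
    · exact Or.inr h.le
  refine (measure_mono hsubset).trans ((measure_union_le _ _).trans ?_)
  rw [two_mul]
  refine add_le_add (one_sided X hX hm hv) (one_sided _ hX.fun_neg ?_ ?_)
  · rw [integral_neg, hm, neg_zero]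
  · rwa [variance_fun_neg]

end GaussianFamily

/-! ### Reflection principle and maximal inequality for Gaussian sheets. -/

section Reflection

variable {Ω ι T : Type*} [MeasurableSpace Ω] {P : Measure Ω} [Fintype ι] [DecidableEq ι]

/-- The covariance of a Brownian sheet in the decreasing time scales `τ`. -/
def sheetCov (τ : ι → T → ℝ) (p q : ι → T) : ℝ := ∏ k, min (τ k (p k)) (τ k (q k))

theorem sheetCov_eq_mul (τ : ι → T → ℝ) (k : ι) (p q : ι → T) :
    sheetCov τ p q = min (τ k (p k)) (τ k (q k)) *
      ∏ j ∈ Finset.univ.erase k, min (τ j (p j)) (τ j (q j)) :=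
  (Finset.mul_prod_erase _ _ (Finset.mem_univ k)).symm

variable [LinearOrder T]

/-- The process reflected at level `v` of coordinate `k`. -/
def reflect (k : ι) (v : T) (X : (ι → T) → Ω → ℝ) (p : ι → T) (ω : Ω) : ℝ :=
  if p k < v then 2 * X (Function.update p k v) ω - X p ω else X p ω

theorem isGaussianProcess_reflect {X : (ι → T) → Ω → ℝ} (hX : IsGaussianProcess X P) (k : ι)
    (v : T) : IsGaussianProcess (reflect k v X) P := by
  classical
  refine hX.of_isGaussianProcess fun p => ⟨{p, Function.update p k v},
    if p k < v then (2 : ℝ) • ContinuousLinearMap.proj ⟨Function.update p k v, by simp⟩ -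
      ContinuousLinearMap.proj ⟨p, by simp⟩
    else ContinuousLinearMap.proj ⟨p, by simp⟩, fun ω => ?_⟩
  unfold reflect
  split_ifs <;> simp

theorem integral_reflect {X : (ι → T) → Ω → ℝ} (hX : IsGaussianProcess X P)
    (hm : ∀ p, ∫ ω, X p ω ∂P = 0) (k : ι) (v : T) (p : ι → T) :
    ∫ ω, reflect k v X p ω ∂P = 0 := by
  have hint : ∀ p, Integrable (X p) P := fun p => (hX.hasGaussianLaw_eval p).integrable
  unfold reflect
  split_ifs
  · rw [integral_sub ((hint _).const_mul _) (hint _), integral_const_mul, hm, hm]; simp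
  · exact hm p

/-- Since `τ k` decreases, `p k < v` means a time after `τ k v`, so only the future is reflected.
For two future points the cross terms cancel the added `τ k v` terms; for a future and a past point
both minima equal the past time. Hence reflection preserves the law. -/
theorem covariance_reflect {X : (ι → T) → Ω → ℝ} (hX : IsGaussianProcess X P)
    {τ : ι → T → ℝ} (hτ : ∀ k, Antitone (τ k)) (hc : ∀ p q, cov[X p, X q; P] = sheetCov τ p q)
    (k : ι) (v : T) (p q : ι → T) :
    cov[reflect k v X p, reflect k v X q; P] = sheetCov τ p q := by
  have hP := hX.isProbabilityMeasure
  have hL : ∀ p, MemLp (X p) 2 P := fun p => (hX.hasGaussianLaw_eval p).memLp_two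
  have hL2 : ∀ p, MemLp (fun ω => 2 * X p ω) 2 P := fun p => (hL p).const_mul 2
  have hprod : ∀ p' q' : ι → T, (∀ j, j ≠ k → p' j = p j) → (∀ j, j ≠ k → q' j = q j) →
      ∏ j ∈ Finset.univ.erase k, min (τ j (p' j)) (τ j (q' j)) =
      ∏ j ∈ Finset.univ.erase k, min (τ j (p j)) (τ j (q j)) := fun p' q' h h' =>
    Finset.prod_congr rfl fun j hj => by rw [h j (Finset.ne_of_mem_erase hj),
      h' j (Finset.ne_of_mem_erase hj)]
  have hu : ∀ r : ι → T, ∀ j, j ≠ k → Function.update r k v j = r j := fun r j hj =>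
    Function.update_of_ne hj _ _
  have hr : ∀ r : ι → T, ∀ j, j ≠ k → r j = r j := fun _ _ _ => rfl
  have e1 : cov[X p, X (Function.update q k v); P] = min (τ k (p k)) (τ k v) *
      ∏ j ∈ Finset.univ.erase k, min (τ j (p j)) (τ j (q j)) := by
    rw [hc, sheetCov_eq_mul τ k, hprod _ _ (hr p) (hu q), Function.update_self]
  have e2 : cov[X (Function.update p k v), X q; P] = min (τ k v) (τ k (q k)) *
      ∏ j ∈ Finset.univ.erase k, min (τ j (p j)) (τ j (q j)) := by
    rw [hc, sheetCov_eq_mul τ k, hprod _ _ (hu p) (hr q), Function.update_self]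
  have e3 : cov[X (Function.update p k v), X (Function.update q k v); P] = τ k v *
      ∏ j ∈ Finset.univ.erase k, min (τ j (p j)) (τ j (q j)) := by
    rw [hc, sheetCov_eq_mul τ k, hprod _ _ (hu p) (hu q), Function.update_self,
      Function.update_self, min_self]
  have e4 : cov[X p, X q; P] = min (τ k (p k)) (τ k (q k)) *
      ∏ j ∈ Finset.univ.erase k, min (τ j (p j)) (τ j (q j)) := by
    rw [hc, sheetCov_eq_mul τ k]
  rw [← hc]
  have hfun : ∀ r, reflect k v X r =
      if r k < v then (fun ω => 2 * X (Function.update r k v) ω - X r ω) else X r := fun r => by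
    unfold reflect; split_ifs <;> rfl
  rw [hfun p, hfun q]
  split_ifs with hp hq hq
  · rw [covariance_fun_sub_fun_sub (hL2 _) (hL _) (hL2 _) (hL _), covariance_const_mul_left,
      covariance_const_mul_right, covariance_const_mul_left, covariance_const_mul_right,
      e1, e2, e3, min_eq_right (hτ k hp.le), min_eq_left (hτ k hq.le)]
    ring
  · rw [covariance_fun_sub_left (hL2 _) (hL _) (hL _), covariance_const_mul_left,
      e2, e4, min_eq_right (hτ k (not_lt.1 hq)),
      min_eq_right (hτ k (hp.le.trans (not_lt.1 hq)))]
    ring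
  · rw [covariance_fun_sub_right (hL _) (hL2 _) (hL _), covariance_const_mul_right,
      e1, e4, min_eq_left (hτ k (not_lt.1 hp)),
      min_eq_left (hτ k (hq.le.trans (not_lt.1 hp)))]
    ring
  · rfl

/-- Lévy's maximal inequality for one coordinate of a Gaussian sheet. -/
theorem measure_exists_lt_abs_le_two_mul {X : (ι → T) → Ω → ℝ} (hX : IsGaussianProcess X P)
    (hm : ∀ p, ∫ ω, X p ω ∂P = 0) {τ : ι → T → ℝ} (hτ : ∀ k, Antitone (τ k))
    (hc : ∀ p q, cov[X p, X q; P] = sheetCov τ p q) (k : ι) {z : T} (hz : ∀ t, z ≤ t)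
    (B : Finset (ι → T)) (u : ℝ) :
    P {ω | ∃ p ∈ B, u < |X p ω|} ≤
      2 * P {ω | ∃ p ∈ B, u < |X (Function.update p k z) ω|} := by
  classical
  set F : Set Ω := {ω | ∃ p ∈ B, u < |X (Function.update p k z) ω|}
  -- First passage in the time `τ k`: `v` is the largest `k`-coordinate in `B` at which the level
  -- `u` is exceeded.
  let A : T → Set Ω := fun v => {ω | (∃ p ∈ B, p k = v ∧ u < |X p ω|) ∧
    ∀ q ∈ B, v < q k → |X q ω| ≤ u}
  let f : B ⊕ B → (ι → T) := Sum.elim (fun p => p.1) (fun p => Function.update p.1 k z)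
  let S : T → Set (B ⊕ B → ℝ) := fun v => {y | ((∃ p : B, p.1 k = v ∧ u < |y (.inl p)|) ∧
    ∀ q : B, v < q.1 k → |y (.inl q)| ≤ u) ∧ ∃ p : B, u < |y (.inr p)|}
  have hS : ∀ v, MeasurableSet (S v) := fun v => by
    have h₁ : MeasurableSet {y : B ⊕ B → ℝ | ∃ p : B, p.1 k = v ∧ u < |y (.inl p)|} := by
      simp only [Set.ofPred_exists, Set.ofPred_and]
      refine MeasurableSet.iUnion fun p => (MeasurableSet.const _).inter ?_
      exact measurableSet_lt measurable_const (by fun_prop)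
    have h₂ : MeasurableSet {y : B ⊕ B → ℝ | ∀ q : B, v < q.1 k → |y (.inl q)| ≤ u} := by
      simp only [Set.ofPred_forall]
      refine MeasurableSet.iInter fun p => MeasurableSet.iInter fun _ => ?_
      exact measurableSet_le (by fun_prop) measurable_const
    have h₃ : MeasurableSet {y : B ⊕ B → ℝ | ∃ p : B, u < |y (.inr p)|} := by
      simp only [Set.ofPred_exists]
      exact MeasurableSet.iUnion fun p => measurableSet_lt measurable_const (by fun_prop)
    exact (h₁.inter h₂).inter h₃
  have hXf : IsGaussianProcess (fun i => X (f i)) P := hX.comp_right f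
  have hAF : ∀ v, A v ∩ F = (fun ω i => X (f i) ω) ⁻¹' S v := fun v => by
    ext ω
    simp [A, F, S, f, Subtype.exists, Subtype.forall, and_left_comm]
  have hAFm : ∀ v, NullMeasurableSet (A v ∩ F) P := fun v => by
    rw [hAF]
    exact hXf.hasGaussianLaw_pi.aemeasurable.nullMeasurableSet_preimage (hS v)
  -- Reflection at `v` leaves the values deciding `A v` untouched. If the corner value `b` has `|b|
  -- ≤ u` while `|a| > u` at passage, its reflection satisfies `|2a - b| ≥ 2|a| - |b| > u`. So `A v`
  -- is covered by `A v ∩ F` and its reflected copy, which has the same probability.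
  have hA : ∀ v, P (A v) ≤ 2 * P (A v ∩ F) := fun v => by
    have hYf : IsGaussianProcess (fun i => reflect k v X (f i)) P :=
      (isGaussianProcess_reflect hX k v).comp_right f
    have hlaw := hXf.map_eq_of_covariance_eq hYf
      (fun i => by rw [hm, integral_reflect hX hm])
      (fun i j => by rw [hc, covariance_reflect hX hτ hc])
    have heq : P ((fun ω i => reflect k v X (f i) ω) ⁻¹' S v) = P (A v ∩ F) := by
      rw [hAF, ← Measure.map_apply_of_aemeasurable hXf.hasGaussianLaw_pi.aemeasurable (hS v),
        hlaw, Measure.map_apply_of_aemeasurable hYf.hasGaussianLaw_pi.aemeasurable (hS v)]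
    rw [two_mul]
    nth_rewrite 2 [← heq]
    refine (measure_mono fun ω hω => ?_).trans (measure_union_le _ _)
    obtain ⟨p, hpB, hpv, hpu⟩ := hω.1
    by_cases h : u < |X (Function.update p k z) ω|
    · exact Or.inl ⟨hω, p, hpB, h⟩
    · refine Or.inr ⟨⟨⟨⟨p, hpB⟩, hpv, ?_⟩, fun q hq => ?_⟩, ⟨p, hpB⟩, ?_⟩
      · simpa [f, reflect, hpv] using hpu
      · simpa [f, reflect, hq.not_gt] using hω.2 q.1 q.2 hq
      · have hval : reflect k v X (Function.update p k z) ω =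
            2 * X p ω - X (Function.update p k z) ω := by
          have hup : Function.update p k v = p := by rw [← hpv, Function.update_eq_self]
          unfold reflect
          rw [Function.update_self, Function.update_idem, hup]
          split_ifs with hzv
          · rfl
          · have : z = v := le_antisymm (hz v) (not_lt.1 hzv)
            rw [this, hup]; ring
        change u < |reflect k v X (Function.update p k z) ω|
        rw [hval]
        have h1 := abs_sub_abs_le_abs_sub (2 * X p ω) (X (Function.update p k z) ω)
        rw [abs_mul, abs_two] at h1
        linarith [not_lt.1 h]
  have hcover : {ω | ∃ p ∈ B, u < |X p ω|} ⊆ ⋃ v ∈ B.image (fun p => p k), A v := by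
    rintro ω ⟨p, hp, hpu⟩
    obtain ⟨q, hq, hmax⟩ := (B.filter fun p => u < |X p ω|).exists_max_image (fun p => p k)
      ⟨p, Finset.mem_filter.2 ⟨hp, hpu⟩⟩
    rw [Finset.mem_filter] at hq
    refine Set.mem_iUnion₂.2 ⟨q k, Finset.mem_image_of_mem _ hq.1, ⟨q, hq.1, rfl, hq.2⟩, ?_⟩
    intro r hr hqr
    by_contra! hru
    exact absurd (hmax r (Finset.mem_filter.2 ⟨hr, hru⟩)) (not_le.2 hqr)
  have hdisj : ∀ v w, v < w → Disjoint (A v) (A w) := fun v w hvw =>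
    Set.disjoint_left.2 fun ω h₁ h₂ => by
      obtain ⟨p, hp, hpw, hpu⟩ := h₂.1
      exact absurd (h₁.2 p hp (hpw ▸ hvw)) (not_le.2 hpu)
  calc P {ω | ∃ p ∈ B, u < |X p ω|}
      ≤ ∑ v ∈ B.image (fun p => p k), P (A v) :=
        (measure_mono hcover).trans (measure_biUnion_finset_le _ _)
    _ ≤ ∑ v ∈ B.image (fun p => p k), 2 * P (A v ∩ F) := Finset.sum_le_sum fun v _ => hA v
    _ = 2 * P (⋃ v ∈ B.image (fun p => p k), A v ∩ F) := by
        rw [← Finset.mul_sum, measure_biUnion_finset₀ _ fun v _ => hAFm v]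
        intro v _ w _ hvw
        refine Disjoint.aedisjoint ?_
        rcases lt_or_gt_of_ne hvw with h | h
        · exact (hdisj v w h).mono Set.inter_subset_left Set.inter_subset_left
        · exact (hdisj w v h).symm.mono Set.inter_subset_left Set.inter_subset_left
    _ ≤ 2 * P F := by
        gcongr
        exact Set.iUnion₂_subset fun v _ => Set.inter_subset_right

/-- The maximum of a Gaussian sheet over a finite set is controlled by its value at the corner. -/
theorem measure_exists_mem_lt_abs_le {X : (ι → T) → Ω → ℝ} (hX : IsGaussianProcess X P)
    (hm : ∀ p, ∫ ω, X p ω ∂P = 0) {τ : ι → T → ℝ} (hτ : ∀ k, Antitone (τ k))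
    (hc : ∀ p q, cov[X p, X q; P] = sheetCov τ p q) {z : T} (hz : ∀ t, z ≤ t)
    (B : Finset (ι → T)) (u : ℝ) :
    P {ω | ∃ p ∈ B, u < |X p ω|} ≤ 2 ^ Fintype.card ι * P {ω | u < |X (fun _ => z) ω|} := by
  classical
  -- The coordinates in `K` are moved to `z` one at a time, each move costing a factor `2`.
  have key : ∀ K : Finset ι, P {ω | ∃ p ∈ B, u < |X p ω|} ≤
      2 ^ K.card * P {ω | ∃ p ∈ B.image (fun p => K.piecewise (fun _ => z) p), u < |X p ω|} := by
    intro K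
    induction K using Finset.induction_on with
    | empty => simp
    | insert k K hk ih =>
      refine ih.trans ?_
      rw [Finset.card_insert_of_notMem hk, pow_succ, mul_assoc]
      gcongr
      refine (measure_exists_lt_abs_le_two_mul hX hm hτ hc k hz _ u).trans
        (mul_le_mul' le_rfl (measure_mono ?_))
      rintro ω ⟨p, hp, hpu⟩
      obtain ⟨q, hq, rfl⟩ := Finset.mem_image.1 hp
      refine ⟨_, Finset.mem_image_of_mem _ hq, ?_⟩
      rwa [Finset.piecewise_insert]
  refine (key Finset.univ).trans ?_
  rw [Finset.card_univ]
  refine mul_le_mul' le_rfl (measure_mono ?_)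
  rintro ω ⟨p, hp, hpu⟩
  obtain ⟨q, hq, rfl⟩ := Finset.mem_image.1 hp
  simpa using hpu

/-- Sub-Gaussian tail of the supremum of a continuous Gaussian sheet over the orthant. -/
theorem measure_exists_lt_abs_le {X : (ι → ℝ≥0) → Ω → ℝ} (hX : IsGaussianProcess X P)
    (hm : ∀ p, ∫ ω, X p ω ∂P = 0) {τ : ι → ℝ≥0 → ℝ} (hτ : ∀ k, Antitone (τ k))
    (hc : ∀ p q, cov[X p, X q; P] = sheetCov τ p q)
    (hcont : ∀ᵐ ω ∂P, Continuous fun p => X p ω) {σ : ℝ} (hσ : 0 < σ)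
    (hτσ : ∏ k, τ k 0 ≤ σ) {u : ℝ} (hu : 0 ≤ u) :
    P {ω | ∃ p, u < |X p ω|} ≤
      2 ^ (Fintype.card ι + 1) * ENNReal.ofReal (Real.exp (-u ^ 2 / (2 * σ))) := by
  -- The finite bound does not depend on the set, so it passes to a countable dense set by monotone
  -- union, and then to all points because continuity makes the exceedance set open.
  obtain ⟨D, hDc, hDd⟩ := TopologicalSpace.exists_countable_dense (ι → ℝ≥0)
  have hzero : P {ω | u < |X (fun _ => 0) ω|} ≤
      2 * ENNReal.ofReal (Real.exp (-u ^ 2 / (2 * σ))) := by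
    refine (hX.hasGaussianLaw_eval _).measure_lt_abs_le (hm _) ?_ hσ hu
    rw [← covariance_self (hX.aemeasurable _), hc]
    simpa [sheetCov] using hτσ
  have hD : P {ω | ∃ p ∈ D, u < |X p ω|} ≤
      2 ^ (Fintype.card ι + 1) * ENNReal.ofReal (Real.exp (-u ^ 2 / (2 * σ))) := by
    have := hDc.to_subtype
    have hU : {ω | ∃ p ∈ D, u < |X p ω|} =
        ⋃ B : Finset D, {ω | ∃ p ∈ B.map (Function.Embedding.subtype _), u < |X p ω|} := by
      ext ω
      simp only [Set.mem_iUnion, Set.mem_ofPred_eq]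
      constructor
      · rintro ⟨p, hp, h⟩
        exact ⟨{⟨p, hp⟩}, p, by simp, h⟩
      · rintro ⟨B, p, hp, h⟩
        obtain ⟨q, -, rfl⟩ := Finset.mem_map.1 hp
        exact ⟨q, q.2, h⟩
    rw [hU, Directed.measure_iUnion]
    · refine iSup_le fun B => (measure_exists_mem_lt_abs_le hX hm hτ hc
        (fun _ => zero_le) _ u).trans ?_
      rw [pow_succ, mul_assoc]
      gcongr
    · refine Monotone.directed_le fun B C hBC ω => ?_
      rintro ⟨p, hp, h⟩
      exact ⟨p, Finset.map_subset_map.2 hBC hp, h⟩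
  refine (measure_mono_ae ?_).trans hD
  filter_upwards [hcont] with ω hω
  rintro ⟨p, hp⟩
  obtain ⟨q, hq, hqD⟩ := hDd.inter_open_nonempty {q | u < |X q ω|}
    (isOpen_lt continuous_const hω.abs) ⟨p, hp⟩
  exact ⟨q, hqD, hq⟩

end Reflection

namespace BlockIsotonic

variable {d : ℕ}

/-! ### The normalised noise as a time-inverted Brownian sheet. -/

section Noise

variable {Ω : Type*} [MeasurableSpace Ω] {P : Measure Ω} {κ : Fin d}
  {G : Orthant d × Orthant d → Ω → ℝ}

/-- The decreasing time change under which the normalised noise becomes a Brownian sheet. -/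
noncomputable def timeScale (κ : Fin d) (b : Orthant d) (k : Fin d) (x : ℝ≥0) : ℝ :=
  if κ ≤ k then ((x : ℝ) + b k)⁻¹ else 1

theorem timeScale_antitone {b : Orthant d} (hb : ∀ k, 0 < b k) (κ k : Fin d) :
    Antitone (timeScale κ b k) := by
  intro x y hxy
  have := NNReal.coe_pos.2 (hb k)
  unfold timeScale
  split_ifs
  · have : (x : ℝ) ≤ y := hxy
    gcongr
  · rfl

theorem min_add_div_mul_eq_min_inv {x y b : ℝ} (hx : 0 < x + b) (hy : 0 < y + b) :
    (min x y + b) / ((x + b) * (y + b)) = min (x + b)⁻¹ (y + b)⁻¹ := by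
  rcases le_total x y with h | h
  · rw [min_eq_left h, min_eq_right (inv_anti₀ hx (by linarith))]
    field_simp
  · rw [min_eq_right h, min_eq_left (inv_anti₀ hy (by linarith))]
    field_simp

/-- Tail bound for the normalised noise along a section of `ℝ≥0^d × ℝ≥0^d` on which one of the two
arguments is frozen at `b`. -/
theorem IsNoise.measure_exists_lt_le (hG : IsNoise P κ G) {b : Orthant d} (hb : ∀ k, 0 < b k)
    (hb1 : ∀ k, b k ≤ 1) {e : Orthant d → Orthant d × Orthant d} (he : Continuous e)
    (hmin : ∀ g g' k, min ((e g).1 k) ((e g').1 k) + min ((e g).2 k) ((e g').2 k) =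
      min (g k) (g' k) + b k) {u : ℝ} (hu : 0 ≤ u) :
    P {ω | ∃ g, u < |G (e g) ω / ∏ k ∈ upperCoords κ, ((g k : ℝ) + b k)|} ≤
      2 ^ (d + 1) * ENNReal.ofReal (Real.exp (-u ^ 2 / (2 * ∏ k, (b k : ℝ)⁻¹))) := by
  have hb' : ∀ k, (0 : ℝ) < b k := fun k => NNReal.coe_pos.2 (hb k)
  have hpos : ∀ (g : Orthant d) k, (0 : ℝ) < g k + b k := fun g k =>
    add_pos_of_nonneg_of_pos (g k).2 (hb' k)
  set N : Orthant d → ℝ := fun g => ∏ k ∈ upperCoords κ, ((g k : ℝ) + b k)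
  have hN : ∀ g, 0 < N g := fun g => Finset.prod_pos fun k _ => hpos g k
  have hgauss : IsGaussianProcess (fun g ω => G (e g) ω / N g) P := by
    have := (hG.gaussian.comp_right e).smul fun g => (N g)⁻¹
    simpa [div_eq_inv_mul] using this
  have hcont : ∀ᵐ ω ∂P, Continuous fun g => G (e g) ω / N g := by
    filter_upwards [hG.continuous_paths] with ω hω
    refine (hω.comp he).div ?_ fun g => (hN g).ne'
    exact continuous_finsetProd _ fun k _ => by fun_prop
  have hcov : ∀ g g', cov[fun ω => G (e g) ω / N g, fun ω => G (e g') ω / N g'; P] =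
      sheetCov (timeScale κ b) g g' := by
    intro g g'
    rw [covariance_fun_div_left, covariance_fun_div_right, hG.covariance_eq, div_div,
      mul_comm (N g'), ← Finset.prod_mul_distrib, ← Finset.prod_div_distrib]
    have : sheetCov (timeScale κ b) g g' =
        ∏ k ∈ upperCoords κ, min ((g k : ℝ) + b k)⁻¹ ((g' k : ℝ) + b k)⁻¹ := by
      unfold sheetCov upperCoords timeScale
      rw [Finset.prod_filter]
      refine Finset.prod_congr rfl fun k _ => ?_
      split_ifs <;> simp
    rw [this]
    refine Finset.prod_congr rfl fun k _ => ?_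
    rw [hmin, ← min_add_div_mul_eq_min_inv (hpos g k) (hpos g' k)]
    push_cast
    rfl
  -- The coordinates below `κ` contribute `1 ≤ (b k)⁻¹`, which makes the variance bound independent
  -- of `κ`.
  have hσ : ∏ k, timeScale κ b k 0 ≤ ∏ k, (b k : ℝ)⁻¹ := by
    refine Finset.prod_le_prod (fun k _ => ?_) fun k _ => ?_
    · unfold timeScale
      split_ifs
      · simp
      · exact zero_le_one
    · unfold timeScale
      split_ifs
      · simp
      · exact (one_le_inv₀ (hb' k)).2 (hb1 k)
  have h := measure_exists_lt_abs_le hgauss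
    (fun g => by rw [integral_div, hG.centered, zero_div])
    (fun k => timeScale_antitone hb κ k) hcov hcont
    (Finset.prod_pos fun k _ => inv_pos.2 (hb' k)) hσ hu
  rwa [Fintype.card_fin] at h

end Noise

/-! ### Deterministic bounds for a single sample path. -/

section Path

theorem Smoothness.one_le_exp {α : Smoothness d} {k : Fin d} (hk : (k : ℕ) < α.s) :
    1 ≤ α.exp k := by
  have htop := ((α.lt_top_iff k).2 hk).ne
  have h := α.one_le k
  rw [← ENat.natCast_toNat htop] at h
  exact_mod_cast h

theorem neg_one_le_pow_sub_pow_div {b g : ℝ} (hb : 0 < b) (hb1 : b ≤ 1) (hg : 0 < g) (n : ℕ) :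
    -1 ≤ (g ^ (n + 1) - b ^ (n + 1)) / (g + b) := by
  rw [le_div_iff₀ (by positivity)]
  have h1 : b ^ (n + 1) ≤ b := pow_le_of_le_one hb.le hb1 n.succ_ne_zero
  have h2 : 0 < g ^ (n + 1) := by positivity
  linarith

/-- For `g ≥ 1` and `n ≥ 1` the numerator is at least `g ^ 2 - 1 ≥ (g - 1) (g + b)`; for `g ≤ 1` the
lower bound `-1` suffices. The estimate is uniform in the exponent. -/
theorem le_pow_sub_pow_div_add_two {b g : ℝ} (hb : 0 < b) (hb1 : b ≤ 1) (hg : 0 < g) {n : ℕ}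
    (hn : 1 ≤ n) : g ≤ (g ^ (n + 1) - b ^ (n + 1)) / (g + b) + 2 := by
  rcases le_total g 1 with h | h
  · linarith [neg_one_le_pow_sub_pow_div hb hb1 hg n]
  · have h1 : b ^ (n + 1) ≤ 1 := pow_le_one₀ hb.le hb1
    have h2 : g ^ 2 ≤ g ^ (n + 1) := pow_le_pow_right₀ h (by omega)
    have : g - 1 ≤ (g ^ (n + 1) - b ^ (n + 1)) / (g + b) := by
      rw [le_div_iff₀ (by positivity)]
      nlinarith
    linarith

/-- The bias `∑ (g_k ^ (α_k + 1) - b_k ^ (α_k + 1)) / (g_k + b_k)` of a point `g` relative to `b`. -/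
noncomputable def bias (α : Smoothness d) (κ : Fin d) (b g : Orthant d) : ℝ :=
  ∑ k ∈ activeCoords α κ,
    ((g k : ℝ) ^ (α.exp k + 1) - (b k : ℝ) ^ (α.exp k + 1)) / ((g k : ℝ) + b k)

variable {α : Smoothness d} {κ : Fin d} {b g : Orthant d}

theorem card_activeCoords_le (α : Smoothness d) (κ : Fin d) : (activeCoords α κ).card ≤ d := by
  simpa using (activeCoords α κ).card_le_univ

theorem neg_natCast_le_bias (hb : ∀ k, 0 < b k) (hb1 : ∀ k, b k ≤ 1) (hg : ∀ k, 0 < g k) :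
    -(d : ℝ) ≤ bias α κ b g := by
  have h : (activeCoords α κ).card • (-1 : ℝ) ≤ bias α κ b g :=
    Finset.card_nsmul_le_sum _ _ _ fun k _ => neg_one_le_pow_sub_pow_div
      (NNReal.coe_pos.2 (hb k)) (by exact_mod_cast hb1 k) (NNReal.coe_pos.2 (hg k)) _
  have hc : ((activeCoords α κ).card : ℝ) ≤ d := by exact_mod_cast card_activeCoords_le α κ
  rw [nsmul_eq_mul] at h
  linarith

/-- A large coordinate cannot be compensated by the others, each of which contributes at least `-1`.
-/
theorem coe_le_bias_add (hb : ∀ k, 0 < b k) (hb1 : ∀ k, b k ≤ 1) (hg : ∀ k, 0 < g k)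
    {k : Fin d} (hk : k ∈ activeCoords α κ) : (g k : ℝ) ≤ bias α κ b g + d + 2 := by
  have hterm : ∀ j, -1 ≤
      ((g j : ℝ) ^ (α.exp j + 1) - (b j : ℝ) ^ (α.exp j + 1)) / ((g j : ℝ) + b j) := fun j =>
    neg_one_le_pow_sub_pow_div (NNReal.coe_pos.2 (hb j)) (by exact_mod_cast hb1 j)
      (NNReal.coe_pos.2 (hg j)) _
  have hk' := le_pow_sub_pow_div_add_two (NNReal.coe_pos.2 (hb k)) (by exact_mod_cast hb1 k)
    (NNReal.coe_pos.2 (hg k)) (Smoothness.one_le_exp (Finset.mem_filter.1 hk).2.2)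
  have h : ((activeCoords α κ).erase k).card • (-1 : ℝ) ≤ _ :=
    Finset.card_nsmul_le_sum _ _ _ fun j _ => hterm j
  have hsum := Finset.add_sum_erase _ (fun j =>
    ((g j : ℝ) ^ (α.exp j + 1) - (b j : ℝ) ^ (α.exp j + 1)) / ((g j : ℝ) + b j)) hk
  have hc : (((activeCoords α κ).erase k).card : ℝ) ≤ d := by
    exact_mod_cast (Finset.card_le_card (Finset.erase_subset _ _)).trans (card_activeCoords_le α κ)
  rw [nsmul_eq_mul] at h
  simp only [bias]
  linarith

theorem V_left_eq (γ : Orthant d × Orthant d → ℝ) (b g : Orthant d) :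
    V α κ γ g b = γ (g, b) / ∏ k ∈ upperCoords κ, ((g k : ℝ) + b k) - bias α κ b g := by
  unfold V bias
  rw [sub_eq_add_neg, ← Finset.sum_neg_distrib]
  congr 1
  refine Finset.sum_congr rfl fun k _ => ?_
  rw [← neg_div, neg_sub, add_comm (g k : ℝ)]

theorem V_right_eq (γ : Orthant d × Orthant d → ℝ) (b g : Orthant d) :
    V α κ γ b g = γ (b, g) / ∏ k ∈ upperCoords κ, ((g k : ℝ) + b k) + bias α κ b g := by
  unfold V bias
  simp_rw [add_comm (b _ : ℝ)]

theorem VSupInf_le_VInfSup (x₀ : Fin d → ℝ) (γ : Orthant d × Orthant d → ℝ) :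
    VSupInf x₀ α κ γ ≤ VInfSup x₀ α κ γ :=
  iSup₂_le fun g₁ h₁ => le_iInf₂ fun g₂ h₂ =>
    (iInf₂_le (f := fun g (_ : g ∈ G2 x₀ α) => (V α κ γ g₁ g : EReal)) g₂ h₂).trans
      (le_iSup₂ (f := fun g (_ : g ∈ G1 x₀ α) => (V α κ γ g g₂ : EReal)) g₁ h₁)

/-- On a path whose normalised values are bounded by `u` along the two sections frozen at `b₁` and
`b₂`, the limit value is at most `(4 (u + d + 1)) ^ ((d + 2) / 2)`. -/
theorem abs_limitValue_le {x₀ : Fin d → ℝ} {γ : Orthant d × Orthant d → ℝ} {b₁ b₂ : Orthant d}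
    (hb₁ : b₁ ∈ G1 x₀ α) (hb₂ : b₂ ∈ G2 x₀ α) (hb₁1 : ∀ k, b₁ k ≤ 1) (hb₂1 : ∀ k, b₂ k ≤ 1)
    {u : ℝ} (hu : 0 ≤ u)
    (h₁ : ∀ g : Orthant d, |γ (g, b₂) / ∏ k ∈ upperCoords κ, ((g k : ℝ) + b₂ k)| ≤ u)
    (h₂ : ∀ g : Orthant d, |γ (b₁, g) / ∏ k ∈ upperCoords κ, ((g k : ℝ) + b₁ k)| ≤ u)
    {g₁ g₂ : Orthant d} (hopt : IsOptimalPair x₀ α κ γ g₁ g₂) :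
    (limitValue x₀ α κ γ g₁ g₂).abs ≤
      ENNReal.ofReal ((4 * (u + d + 1)) ^ (((d : ℝ) + 2) / 2)) := by
  have hd0 : (0 : ℝ) ≤ d := d.cast_nonneg
  have hup : VInfSup x₀ α κ γ ≤ ((u + d : ℝ) : EReal) := by
    refine (iInf₂_le b₂ hb₂).trans (iSup₂_le fun g hg => EReal.coe_le_coe_iff.2 ?_)
    rw [V_left_eq]
    linarith [(abs_le.1 (h₁ g)).2, neg_natCast_le_bias (α := α) (κ := κ) hb₂.1 hb₂1 hg.1]
  have hlo : ((-(u + d) : ℝ) : EReal) ≤ VSupInf x₀ α κ γ := by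
    refine le_trans (le_iInf₂ fun g hg => EReal.coe_le_coe_iff.2 ?_)
      (le_iSup₂ (f := fun g₁ (_ : g₁ ∈ G1 x₀ α) => ⨅ g₂ ∈ G2 x₀ α, (V α κ γ g₁ g₂ : EReal)) b₁ hb₁)
    rw [V_right_eq]
    linarith [(abs_le.1 (h₂ g)).1, neg_natCast_le_bias (α := α) (κ := κ) hb₁.1 hb₁1 hg.1]
  have hle := VSupInf_le_VInfSup (α := α) (κ := κ) x₀ γ
  obtain ⟨v, hv⟩ : ∃ v : ℝ, VSupInf x₀ α κ γ = v :=
    ⟨_, (EReal.coe_toReal ((hle.trans hup).trans_lt (EReal.coe_lt_top _)).ne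
      ((EReal.bot_lt_coe _).trans_le hlo).ne').symm⟩
  obtain ⟨w, hw⟩ : ∃ w : ℝ, VInfSup x₀ α κ γ = w :=
    ⟨_, (EReal.coe_toReal (hup.trans_lt (EReal.coe_lt_top _)).ne
      ((EReal.bot_lt_coe _).trans_le (hlo.trans hle)).ne').symm⟩
  -- Optimality gives `-(u + d) ≤ V α κ γ g₁ b₂ ≤ u - bias`, so the bias is at most `2u + d`, and
  -- every active coordinate at most `2u + 2d + 2`.
  have hg₁ : ∀ k ∈ activeCoords α κ, (g₁ k : ℝ) ≤ 2 * (u + d + 1) := fun k hk => by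
    have h : VSupInf x₀ α κ γ ≤ V α κ γ g₁ b₂ := hopt.attains₁ ▸ iInf₂_le b₂ hb₂
    have h := EReal.coe_le_coe_iff.1 (hlo.trans h)
    rw [V_left_eq] at h
    linarith [(abs_le.1 (h₁ g₁)).2, coe_le_bias_add hb₂.1 hb₂1 hopt.mem₁.1 hk]
  have hg₂ : ∀ k ∈ activeCoords α κ, (g₂ k : ℝ) ≤ 2 * (u + d + 1) := fun k hk => by
    have h : (V α κ γ b₁ g₂ : EReal) ≤ VInfSup x₀ α κ γ := hopt.attains₂ ▸
      le_iSup₂ (f := fun g (_ : g ∈ G1 x₀ α) => (V α κ γ g g₂ : EReal)) b₁ hb₁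
    have h := EReal.coe_le_coe_iff.1 (h.trans hup)
    rw [V_right_eq] at h
    linarith [(abs_le.1 (h₂ g₂)).1, coe_le_bias_add hb₁.1 hb₁1 hopt.mem₂.1 hk]
  set R : ℝ := 4 * (u + d + 1)
  have hR1 : 1 ≤ R := by linarith
  have hS : S α κ g₁ g₂ ≤ R ^ ((d : ℝ) / 2) := by
    have hprod : ∏ k ∈ activeCoords α κ, ((g₂ k : ℝ) + g₁ k) ≤ R ^ d :=
      calc ∏ k ∈ activeCoords α κ, ((g₂ k : ℝ) + g₁ k) ≤ ∏ k ∈ activeCoords α κ, R :=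
            Finset.prod_le_prod (fun k _ => by positivity) fun k hk => by
              linarith [hg₁ k hk, hg₂ k hk]
        _ = R ^ (activeCoords α κ).card := Finset.prod_const _
        _ ≤ R ^ d := pow_le_pow_right₀ hR1 (card_activeCoords_le α κ)
    refine (Real.sqrt_le_sqrt hprod).trans_eq ?_
    rw [Real.sqrt_eq_rpow, ← Real.rpow_natCast, ← Real.rpow_mul (by linarith)]
    ring_nf
  rw [hv, EReal.coe_le_coe_iff] at hlo
  rw [hw, EReal.coe_le_coe_iff] at hup
  rw [hv, hw, EReal.coe_le_coe_iff] at hle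
  rw [limitValue, hv, hw, ← EReal.coe_add, ← EReal.coe_mul, EReal.abs_def]
  refine ENNReal.ofReal_le_ofReal ?_
  have hS0 : 0 ≤ S α κ g₁ g₂ := Real.sqrt_nonneg _
  have hvw : |1 / 2 * (v + w)| ≤ R := abs_le.2 ⟨by linarith, by linarith⟩
  rw [mul_assoc, abs_mul, abs_of_nonneg hS0]
  calc S α κ g₁ g₂ * |1 / 2 * (v + w)| ≤ R ^ ((d : ℝ) / 2) * R := by gcongr
    _ = R ^ (((d : ℝ) + 2) / 2) := by
      rw [← Real.rpow_add_one (by linarith)]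
      ring_nf

end Path

end BlockIsotonic

/-! ### Exceedance probabilities, uniform in smoothness and critical index. -/

namespace BlockIsotonic

variable {d : ℕ}

/-- The exceedance probability at a level above `(4 (u + d + 1)) ^ ((d + 2) / 2)`. -/
theorem measure_exceedance_le {x₀ : Fin d → ℝ} {b₁ b₂ : Orthant d} (hb₁ : ∀ k, 0 < b₁ k)
    (hb₂ : ∀ k, 0 < b₂ k) (hx₁ : ∀ k, (b₁ k : ℝ) = x₀ k) (hx₂ : ∀ k, (b₂ k : ℝ) = 1 - x₀ k)
    {α : Smoothness d} {κ : Fin d} {Ω : Type*} [MeasurableSpace Ω] {P : Measure Ω}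
    {G : Orthant d × Orthant d → Ω → ℝ} (hG : IsNoise P κ G) {u t : ℝ} (hu : 0 ≤ u)
    (hut : (4 * (u + d + 1)) ^ (((d : ℝ) + 2) / 2) ≤ t) :
    P (exceedance x₀ α κ G t) ≤ ENNReal.ofReal
      (2 ^ (d + 2) * Real.exp (-u ^ 2 / (2 * (∏ k, (b₁ k : ℝ)⁻¹ + ∏ k, (b₂ k : ℝ)⁻¹)))) := by
  have hp₁ : ∀ k, (0 : ℝ) < b₁ k := fun k => NNReal.coe_pos.2 (hb₁ k)
  have hp₂ : ∀ k, (0 : ℝ) < b₂ k := fun k => NNReal.coe_pos.2 (hb₂ k)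
  have hb₁1 : ∀ k, b₁ k ≤ 1 := fun k => by
    have := hp₂ k
    have : (b₁ k : ℝ) ≤ 1 := by linarith [hx₁ k, hx₂ k]
    exact_mod_cast this
  have hb₂1 : ∀ k, b₂ k ≤ 1 := fun k => by
    have := hp₁ k
    have : (b₂ k : ℝ) ≤ 1 := by linarith [hx₁ k, hx₂ k]
    exact_mod_cast this
  have hσ₁ : 0 < ∏ k, (b₁ k : ℝ)⁻¹ := Finset.prod_pos fun k _ => inv_pos.2 (hp₁ k)
  have hσ₂ : 0 < ∏ k, (b₂ k : ℝ)⁻¹ := Finset.prod_pos fun k _ => inv_pos.2 (hp₂ k)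
  have tail₂ := hG.measure_exists_lt_le hb₂ hb₂1 (e := fun g => (g, b₂)) (by fun_prop)
    (fun g g' k => by simp) hu
  have tail₁ := hG.measure_exists_lt_le hb₁ hb₁1 (e := fun g => (b₁, g)) (by fun_prop)
    (fun g g' k => by simp [add_comm]) hu
  have hsub : exceedance x₀ α κ G t ⊆
      {ω | ∃ g : Orthant d, u < |G (b₁, g) ω / ∏ k ∈ upperCoords κ, ((g k : ℝ) + b₁ k)|} ∪
      {ω | ∃ g : Orthant d, u < |G (g, b₂) ω / ∏ k ∈ upperCoords κ, ((g k : ℝ) + b₂ k)|} := by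
    rintro ω ⟨g₁, g₂, hopt, hlt⟩
    by_contra hω
    rw [Set.mem_union, not_or] at hω
    refine absurd hlt (not_lt.2 ?_)
    refine (abs_limitValue_le (b₁ := b₁) (b₂ := b₂) ⟨hb₁, fun k _ => (hx₁ k).le⟩
      ⟨hb₂, fun k _ => (hx₂ k).le⟩ hb₁1 hb₂1 hu (fun g => ?_) (fun g => ?_) hopt).trans
      (ENNReal.ofReal_le_ofReal hut)
    · exact not_lt.1 fun h => hω.2 ⟨g, h⟩
    · exact not_lt.1 fun h => hω.1 ⟨g, h⟩
  refine (measure_mono hsub).trans ((measure_union_le _ _).trans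
    ((add_le_add tail₁ tail₂).trans ?_))
  set E : ℝ := Real.exp (-u ^ 2 / (2 * (∏ k, (b₁ k : ℝ)⁻¹ + ∏ k, (b₂ k : ℝ)⁻¹)))
  have mono : ∀ σ : ℝ, 0 < σ → σ ≤ ∏ k, (b₁ k : ℝ)⁻¹ + ∏ k, (b₂ k : ℝ)⁻¹ →
      Real.exp (-u ^ 2 / (2 * σ)) ≤ E := fun σ hσ hle => by
    refine Real.exp_le_exp.2 ?_
    rw [neg_div, neg_div]
    gcongr
  have h2 : (2 : ℝ≥0∞) ^ (d + 2) = ENNReal.ofReal (2 ^ (d + 2)) := by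
    rw [ENNReal.ofReal_pow zero_le_two]; simp
  rw [ENNReal.ofReal_mul (by positivity), ← h2, pow_succ _ (d + 1), mul_assoc,
    two_mul (ENNReal.ofReal E), mul_add]
  gcongr
  · exact mono _ hσ₁ (by linarith)
  · exact mono _ hσ₂ (by linarith)

/-- Uniform tail bound for the limit variable. -/
theorem exists_exceedance_tail_bound (x₀ : Fin d → ℝ) (hx₀ : ∀ k, x₀ k ∈ Set.Ioo (0 : ℝ) 1) :
    ∃ L : ℝ, 1 ≤ L ∧ ∀ (α : Smoothness d) (κ : Fin d) {Ω : Type u} [MeasurableSpace Ω]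
      (P : Measure Ω) [IsProbabilityMeasure P] (G : Orthant d × Orthant d → Ω → ℝ),
      IsNoise P κ G → ∀ t : ℝ, 1 ≤ t →
        P (exceedance x₀ α κ G t) ≤
          ENNReal.ofReal (L * Real.exp (-(t ^ (4 / ((d : ℝ) + 2))) / L)) := by
  let b₁ : Orthant d := fun k => ⟨x₀ k, (hx₀ k).1.le⟩
  let b₂ : Orthant d := fun k => ⟨1 - x₀ k, by linarith [(hx₀ k).2]⟩
  have hb₁ : ∀ k, 0 < b₁ k := fun k => NNReal.coe_pos.1 (hx₀ k).1
  have hb₂ : ∀ k, 0 < b₂ k := fun k => NNReal.coe_pos.1 (sub_pos.2 (hx₀ k).2)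
  set σ : ℝ := ∏ k, (b₁ k : ℝ)⁻¹ + ∏ k, (b₂ k : ℝ)⁻¹ with hσ
  have hσ0 : 0 < σ := add_pos
    (Finset.prod_pos fun k _ => inv_pos.2 (NNReal.coe_pos.2 (hb₁ k)))
    (Finset.prod_pos fun k _ => inv_pos.2 (NNReal.coe_pos.2 (hb₂ k)))
  have hd0 : (0 : ℝ) ≤ d := d.cast_nonneg
  -- The three summands absorb the prefactor of the tail bound, the constant in its exponent, and
  -- the range of small `t`.
  set L : ℝ := 2 ^ (d + 2) + 128 * σ + 64 * ((d : ℝ) + 1) ^ 2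
  have h2 : (1 : ℝ) ≤ 2 ^ (d + 2) := one_le_pow₀ one_le_two
  have hsq : (1 : ℝ) ≤ ((d : ℝ) + 1) ^ 2 := one_le_pow₀ (by linarith)
  have hL1 : 64 ≤ L := by linarith
  refine ⟨L, by linarith, fun α κ Ω _ P _ G hG t ht => ?_⟩
  have ht0 : 0 < t := one_pos.trans_le ht
  set w : ℝ := t ^ (2 / ((d : ℝ) + 2)) with hw
  have hw0 : 0 < w := Real.rpow_pos_of_pos ht0 _
  have hwsq : t ^ (4 / ((d : ℝ) + 2)) = w ^ 2 := by
    rw [hw, ← Real.rpow_natCast, ← Real.rpow_mul ht0.le]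
    congr 1
    push_cast
    ring
  rw [hwsq]
  -- Above this threshold `v = w / 4 - d - 1`, the solution of `4 (v + d + 1) = w`, is still at
  -- least `w / 8`. Below it `w ^ 2 ≤ L`, so the claimed bound is at least `L * exp (-1) ≥ 1` and is
  -- trivial.
  rcases le_total (8 * ((d : ℝ) + 1)) w with h | h
  · set v : ℝ := w / 4 - d - 1 with hv
    have hvw : w / 8 ≤ v := by linarith
    have hv0 : 0 ≤ v := by linarith
    have hle : (4 * (v + d + 1)) ^ (((d : ℝ) + 2) / 2) ≤ t := by
      have h4 : 4 * (v + d + 1) = w := by rw [hv]; ring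
      rw [h4, hw, ← Real.rpow_mul ht0.le]
      have : 2 / ((d : ℝ) + 2) * (((d : ℝ) + 2) / 2) = 1 := by field_simp
      rw [this, Real.rpow_one]
    refine (measure_exceedance_le hb₁ hb₂ (fun _ => rfl) (fun _ => rfl) hG hv0 hle).trans
      (ENNReal.ofReal_le_ofReal ?_)
    rw [← hσ]
    have hL2 : (2 : ℝ) ^ (d + 2) ≤ L := by linarith
    refine mul_le_mul hL2 (Real.exp_le_exp.2 ?_) (Real.exp_nonneg _) (by linarith)
    rw [neg_div, neg_div, neg_le_neg_iff]
    calc w ^ 2 / L ≤ w ^ 2 / (128 * σ) :=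
          div_le_div_of_nonneg_left (sq_nonneg w) (by positivity) (by linarith)
      _ = (w / 8) ^ 2 / (2 * σ) := by field_simp; ring
      _ ≤ v ^ 2 / (2 * σ) := by gcongr
  · refine prob_le_one.trans ?_
    rw [ENNReal.one_le_ofReal]
    have hwL : w ^ 2 / L ≤ 1 := by
      rw [div_le_one (by linarith)]
      have : w ^ 2 ≤ (8 * ((d : ℝ) + 1)) ^ 2 := by gcongr
      nlinarith
    have hexp : Real.exp (-1) ≤ Real.exp (-w ^ 2 / L) :=
      Real.exp_le_exp.2 (by rw [neg_div]; linarith)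
    have h3 : (1 / 3 : ℝ) ≤ Real.exp (-1) := by
      rw [Real.exp_neg, ← one_div]
      exact one_div_le_one_div_of_le (Real.exp_pos 1) (by linarith [Real.exp_one_lt_d9])
    nlinarith

end BlockIsotonic

/-! ### The tail bound and the critical value. -/

theorem mainTheorem4 (d : ℕ) (hd : 1 ≤ d) (x₀ : Fin d → ℝ)
    (hx₀ : ∀ k, x₀ k ∈ Set.Ioo (0 : ℝ) 1) :
    (∃ L₀ : ℝ, 0 < L₀ ∧
      ∀ (α : BlockIsotonic.Smoothness d) (D : BlockIsotonic.Design d) (κ : Fin d),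
        BlockIsotonic.IsCriticalIndex α κ D →
      ∀ {Ω : Type u} [MeasurableSpace Ω] (P : MeasureTheory.Measure Ω)
        [MeasureTheory.IsProbabilityMeasure P]
        (G : BlockIsotonic.Orthant d × BlockIsotonic.Orthant d → Ω → ℝ),
        BlockIsotonic.IsNoise P κ G →
      ∀ t : ℝ, 1 ≤ t →
        P (BlockIsotonic.exceedance x₀ α κ G t) ≤
          ENNReal.ofReal (L₀ * Real.exp (-(t ^ (4 / ((d : ℝ) + 2))) / L₀))) ∧
    (∀ δ₀ ∈ Set.Ioo (0 : ℝ) 1, ∃ C : ℝ, 0 < C ∧ ∀ δ : ℝ, 0 < δ → δ ≤ δ₀ →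
      ∀ (α : BlockIsotonic.Smoothness d) (D : BlockIsotonic.Design d) (κ : Fin d),
        BlockIsotonic.IsCriticalIndex α κ D →
      ∀ {Ω : Type u} [MeasurableSpace Ω] (P : MeasureTheory.Measure Ω)
        [MeasureTheory.IsProbabilityMeasure P]
        (G : BlockIsotonic.Orthant d × BlockIsotonic.Orthant d → Ω → ℝ),
        BlockIsotonic.IsNoise P κ G →
        P (BlockIsotonic.exceedance x₀ α κ G
            (C * Real.log (1 / δ) ^ (((d : ℝ) + 2) / 4))) ≤ ENNReal.ofReal δ) := by
  obtain ⟨L, hL1, htail⟩ := BlockIsotonic.exists_exceedance_tail_bound x₀ hx₀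
  have hL0 : 0 < L := one_pos.trans_le hL1
  refine ⟨⟨L, hL0, fun α _ κ _ Ω _ P _ G hG t ht => htail α κ P G hG t ht⟩, fun δ₀ hδ₀ => ?_⟩
  set m : ℝ := Real.log (1 / δ₀)
  have hm0 : 0 < m := Real.log_pos ((one_lt_div hδ₀.1).2 hδ₀.2)
  have hlogL : 0 ≤ Real.log L := Real.log_nonneg hL1
  -- Chosen so that `B * l ≥ L * (l + log L) + 1` for every `l ≥ m`: the first part turns the tail
  -- bound into `exp (-l) = δ`, and the `1` keeps the level in the range `t ≥ 1`.
  set B : ℝ := L * (1 + Real.log L / m) + 1 / m with hB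
  have hB0 : 0 < B := by positivity
  refine ⟨B ^ (((d : ℝ) + 2) / 4), Real.rpow_pos_of_pos hB0 _,
    fun δ hδ hδle α _ κ _ Ω _ P _ G hG => ?_⟩
  set l : ℝ := Real.log (1 / δ) with hl
  have hml : m ≤ l := Real.log_le_log (one_div_pos.2 hδ₀.1) (one_div_le_one_div_of_le hδ hδle)
  have hl0 : 0 < l := hm0.trans_le hml
  have hBm : L * l + L * Real.log L + 1 ≤ B * l := by
    have h1 : Real.log L ≤ Real.log L / m * l := by
      rw [div_mul_eq_mul_div, le_div_iff₀ hm0]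
      gcongr
    have h2 : 1 ≤ 1 / m * l := by
      rw [div_mul_eq_mul_div, le_div_iff₀ hm0]
      linarith
    calc L * l + L * Real.log L + 1 ≤ L * l + L * (Real.log L / m * l) + 1 / m * l := by gcongr
      _ = B * l := by rw [hB]; ring
  have hBl1 : 1 ≤ B * l := by nlinarith [mul_pos hL0 hl0, mul_nonneg hL0.le hlogL]
  have hd0 : (0 : ℝ) ≤ d := d.cast_nonneg
  rw [← Real.mul_rpow hB0.le hl0.le]
  refine (htail α κ P G hG _ (Real.one_le_rpow hBl1 (by positivity))).trans
    (ENNReal.ofReal_le_ofReal ?_)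
  have hexp : ((d : ℝ) + 2) / 4 * (4 / ((d : ℝ) + 2)) = 1 := by field_simp
  rw [← Real.rpow_mul (by linarith), hexp, Real.rpow_one]
  calc L * Real.exp (-(B * l) / L) ≤ L * Real.exp (-(l + Real.log L)) := by
        gcongr
        rw [neg_div, neg_le_neg_iff, le_div_iff₀ hL0]
        linarith
    _ = Real.exp (-l) := by
        rw [neg_add, Real.exp_add, Real.exp_neg (Real.log L), Real.exp_log hL0]
        field_simp
    _ = δ := by
        rw [hl, one_div, Real.log_inv, neg_neg, Real.exp_log hδ]
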